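/- Let $A$ be a unital C*-algebra with self-adjoint part $A_{\mathrm{sa}}$, ordered by $a\leqslant b$ iff $b-a=c^*c$ for some $c\in A$. Let $\mathcal C(A)$ be the poset of unital commutative C*-subalgebras of $A$, ordered by inclusion, let $\mathcal T(A)=\mathbf{Sets}^{\mathcal C(A)}$ be the topos of functors $\mathcal C(A)\to\mathbf{Sets}$, and let $\underline A$ be the internal commutative C*-algebra $C\mapsto C$, with self-adjoint part $\underline A_{\mathrm{sa}}:C\mapsto C_{\mathrm{sa}}$. The internal Gelfand spectrum $\underline\Sigma$ is the locale in $\mathcal T(A)$ whose frame $\mathcal O(\underline\Sigma)$ is freely generated by symbols $\mathrm D_a$, $a\in\underline A_{\mathrm{sa}}$, subject to $\mathrm D_1=\top$, $\mathrm D_a\wedge \mathrm D_{-a}=\bot$, $\mathrm D_{-b^2}=\bot$, $\mathrm D_{a+b}\leqslant \mathrm D_a\vee \mathrm D_b$, $\mathrm D_{ab}=(\mathrm D_a\wedge \mathrm D_b)\vee(\mathrm D_{-a}\wedge \mathrm D_{-b})$ and $\mathrm D_a\leqslant\bigvee_{r\in\mathbb Q,\,r>0}\mathrm D_{a-r}$.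 The internal interval domain $\underline{\mathbb{IR}}$ is the locale in $\mathcal T(A)$ whose frame is freely generated by symbols $(p,q)$ with $p<q$ rational, subject to: $(p_1,q_1)\wedge(p_2,q_2)=(\max\{p_1,p_2\},\min\{q_1,q_2\})$ if $\max\{p_1,p_2\}<\min\{q_1,q_2\}$ and $=\bot$ otherwise; $(p,q)=\bigvee\{(p',q')\mid p<p'<q'<q\}$; and $\top=\bigvee\{(p,q)\mid p<q\}$. Put $(r,\infty)=\bigvee_{s>r}(r,s)$ and $(-\infty,s)=\bigvee_{r<s}(r,s)$. Let $C(\underline\Sigma,\underline{\mathbb{IR}})$ be the set of locale maps $\varphi:\underline\Sigma\to\underline{\mathbb{IR}}$ in $\mathcal T(A)$, i.e. of internal frame maps $\varphi^{-1}:\mathcal O(\underline{\mathbb{IR}})\to\mathcal O(\underline\Sigma)$, with the pointwise order induced by the order $[x,y]\leqslant[x',y']\Leftrightarrow x\leqslant x'\text{ and }y\leqslant y'$ of intervals; that is, $\varphi\leqslant\psi$ iff, at every stage $C\in\mathcal C(A)$, $\varphi^{-1}(r,\infty)\leqslant\psi^{-1}(r,\infty)$ for all $r\in\mathbb Q$ and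 $\psi^{-1}(-\infty,s)\leqslant\varphi^{-1}(-\infty,s)$ for all $s\in\mathbb Q$. For each $a\in A_{\mathrm{sa}}$ there is a locale map $\delta(a):\underline\Sigma\to\underline{\mathbb{IR}}$ (the Daseinisation of $a$), determined by $$\delta(a)^{-1}(r,s)=\bigvee_{f\leqslant a\leqslant g}\mathrm D_{f-r}\wedge\mathrm D_{s-g}\qquad(r<s\text{ rational}),$$ an internal join over the self-adjoint elements $f,g$ of $\underline A$ with $f\leqslant a\leqslant g$ (at stage $C$: $f,g\in C_{\mathrm{sa}}$). The map $\delta:A_{\mathrm{sa}}\to C(\underline\Sigma,\underline{\mathbb{IR}})$ is injective, and for all $a,b\in A_{\mathrm{sa}}$ one has $a\leqslant b$ if and only if $\delta(a)\leqslant\delta(b)$. -/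

import Mathlib

universe u v w

namespace Bohrification

/-! ## Frames and locales internal to a topos of set-valued functors on a preorder

The objects of the topos `Sets^P` are the functors from the preorder `P` to sets.  The notions
of the internal language are written out through their Kripke-Joyal semantics. -/

/-- An internal meet semilattice with top element in the topos `Sets^P`: a functor
`C ↦ obj C` on `P` whose values are meet semilattices with top and whose transition maps
`obj C → obj D` (`C ≤ D`) preserve finite meets. -/
structure InternalSemilattice (P : Type u) [Preorder P] where
  obj : P → Type v
  [semilatticeInf : ∀ C, SemilatticeInf (obj C)]
  [orderTop : ∀ C, OrderTop (obj C)]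
  res : ∀ {C D : P}, C ≤ D → InfTopHom (obj C) (obj D)
  res_refl : ∀ {C : P} (x : obj C), res (le_refl C) x = x
  res_trans : ∀ {C D E : P} (h : C ≤ D) (k : D ≤ E) (x : obj C),
    res k (res h x) = res (h.trans k) x

attribute [instance] InternalSemilattice.semilatticeInf InternalSemilattice.orderTop

variable {P : Type u} [Preorder P]

/-- An element at stage `C` of the power object of `F`: a subfunctor of the restriction of `F`
to the principal upper set of `C`. -/
structure InternalSubset (F : InternalSemilattice.{u, v} P) (C : P) where
  carrier : ∀ D : P, C ≤ D → Set (F.obj D)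
  res_mem : ∀ {D E : P} (h : C ≤ D) (k : D ≤ E) (x : F.obj D),
    x ∈ carrier D h → F.res k x ∈ carrier E (h.trans k)

namespace InternalSubset

variable {F : InternalSemilattice.{u, v} P} {C : P}

/-- The internal subset `{x ⊓ z | z ∈ S}`. -/
def meet (x : F.obj C) (S : InternalSubset F C) : InternalSubset F C where
  carrier D h := {y | ∃ z ∈ S.carrier D h, y = F.res h x ⊓ z}
  res_mem := by
    rintro D E h k _ ⟨z, hz, rfl⟩
    exact ⟨F.res k z, S.res_mem h k z hz, by rw [map_inf, F.res_trans]⟩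

/-- `b` is the join of the internal subset `S`, in the internal sense: at every later stage `D`,
`b` lies below `y` iff every member of `S` at every stage beyond `D` lies below `y`. -/
def IsJoin (S : InternalSubset F C) (b : F.obj C) : Prop :=
  ∀ (D : P) (h : C ≤ D) (y : F.obj D),
    F.res h b ≤ y ↔ ∀ (E : P) (k : D ≤ E), ∀ z ∈ S.carrier E (h.trans k), z ≤ F.res k y

end InternalSubset

/-- An internal frame in `Sets^P`: an internal meet semilattice with top in which every internal
subset has a join, and in which binary meets distribute over these joins. -/
structure InternalFrame (P : Type u) [Preorder P] extends InternalSemilattice.{u, v} P where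
  join : ∀ {C : P}, InternalSubset toInternalSemilattice C → obj C
  isJoin_join : ∀ {C : P} (S : InternalSubset toInternalSemilattice C), S.IsJoin (join S)
  meet_isJoin : ∀ {C : P} (x : obj C) (S : InternalSubset toInternalSemilattice C) (b : obj C),
    S.IsJoin b → (S.meet x).IsJoin (x ⊓ b)

/-- Internal subsets of an internal frame. -/
abbrev InternalFrame.Subset (F : InternalFrame.{u, v} P) (C : P) :=
  InternalSubset F.toInternalSemilattice C

/-- A map of internal frames: a natural transformation that preserves finite meets and all
internal joins. -/
@[ext]
structure InternalFrameHom (F : InternalFrame.{u, v} P) (G : InternalFrame.{u, w} P) where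
  app : ∀ C : P, InfTopHom (F.obj C) (G.obj C)
  naturality : ∀ {C D : P} (h : C ≤ D) (x : F.obj C), app D (F.res h x) = G.res h (app C x)
  map_isJoin : ∀ {C : P} (S : F.Subset C) (b : F.obj C), S.IsJoin b →
    InternalSubset.IsJoin (F := G.toInternalSemilattice)
      { carrier := fun D h => app D '' S.carrier D h
        res_mem := by
          rintro D E h k _ ⟨x, hx, rfl⟩
          exact ⟨F.res k x, S.res_mem h k x hx, naturality k x⟩ }
      (app C b)

/-- Internal locales are internal frames, with arrows read in the opposite direction: an element
of `LocaleMap X Y`, that is, a locale map `X → Y`, is a frame map `O(Y) → O(X)`, where the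
arguments `X` and `Y` stand for the frames `O(X)` and `O(Y)`. -/
structure LocaleMap (X : InternalFrame.{u, v} P) (Y : InternalFrame.{u, w} P) where
  inverseImage : InternalFrameHom Y X

/-! ## Elementary facts on internal joins -/

section Joins

variable {F : InternalFrame.{u, v} P} {C D : P}

theorem InternalSubset.IsJoin.le_iff {S : F.Subset C} {b : F.obj C} (hb : S.IsJoin b)
    (h : C ≤ D) (y : F.obj D) :
    F.res h b ≤ y ↔ ∀ (E : P) (k : D ≤ E), ∀ z ∈ S.carrier E (h.trans k), z ≤ F.res k y :=
  hb D h y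

theorem InternalSubset.IsJoin.le {S : F.Subset C} {b : F.obj C} (hb : S.IsJoin b)
    (h : C ≤ D) {z : F.obj D} (hz : z ∈ S.carrier D h) : z ≤ F.res h b := by
  have := (hb D h _).1 le_rfl D le_rfl z hz
  rwa [F.res_refl] at this

theorem InternalSubset.IsJoin.le_iff' {S : F.Subset C} {b : F.obj C} (hb : S.IsJoin b)
    (y : F.obj C) :
    b ≤ y ↔ ∀ (E : P) (k : C ≤ E), ∀ z ∈ S.carrier E k, z ≤ F.res k y := by
  have := hb C le_rfl y
  rwa [F.res_refl] at this

theorem InternalSubset.IsJoin.of_le {S : F.Subset C} {b : F.obj C}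
    (h1 : ∀ (E : P) (k : C ≤ E), ∀ z ∈ S.carrier E k, z ≤ F.res k b)
    (h2 : ∀ (D : P) (h : C ≤ D) (y : F.obj D),
      (∀ (E : P) (k : D ≤ E), ∀ z ∈ S.carrier E (h.trans k), z ≤ F.res k y) → F.res h b ≤ y) :
    S.IsJoin b := by
  intro D h y
  refine ⟨fun hy E k z hz => ?_, h2 D h y⟩
  refine (h1 E (h.trans k) z hz).trans ?_
  rw [← F.res_trans h k]
  exact OrderHomClass.mono (F.res k) hy

theorem InternalFrame.join_inf_join_le (S S' : F.Subset C) (y : F.obj C)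
    (H : ∀ (D : P) (h : C ≤ D), ∀ z ∈ S.carrier D h, ∀ z' ∈ S'.carrier D h, z ⊓ z' ≤ F.res h y) :
    F.join S ⊓ F.join S' ≤ y := by
  rw [inf_comm]
  refine ((F.meet_isJoin _ _ _ (F.isJoin_join S)).le_iff' _).2 ?_
  rintro D h _ ⟨z, hz, rfl⟩
  rw [← F.res_refl (F.res h (F.join S') ⊓ z), map_inf, F.res_trans, inf_comm, F.res_refl]
  have hS' : InternalSubset.IsJoin (F := F.toInternalSemilattice)
      { carrier := fun E k => S'.carrier E (h.trans k)
        res_mem := fun k k' x hx => S'.res_mem (h.trans k) k' x hx } (F.res h (F.join S')) := by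
    intro E k x
    rw [F.res_trans]
    exact F.isJoin_join S' E (h.trans k) x
  refine ((F.meet_isJoin _ _ _ hS').le_iff' _).2 ?_
  rintro E k _ ⟨z', hz', rfl⟩
  rw [F.res_trans]
  exact H E (h.trans k) _ (S.res_mem h k z hz) _ hz'

end Joins

/-! ## The internal frame defined by a propositional geometric theory -/

/-- A propositional geometric theory internal to `Sets^P`.  `Gen` is the object of atomic
propositions; a list of elements of `Gen C` stands for the conjunction of its members, and
`Ax C s T` says that `⋀ s ⊢ ⋁ {⋀ t | t ∈ T}` is an axiom at stage `C`. -/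
structure GeometricTheory (P : Type u) [Preorder P] where
  Gen : P → Type w
  map : ∀ {C D : P}, C ≤ D → Gen C → Gen D
  map_refl : ∀ {C : P} (x : Gen C), map (le_refl C) x = x
  map_trans : ∀ {C D E : P} (h : C ≤ D) (k : D ≤ E) (x : Gen C),
    map k (map h x) = map (h.trans k) x
  Ax : ∀ C : P, List (Gen C) → Set (List (Gen C)) → Prop
  ax_map : ∀ {C D : P} (h : C ≤ D) (s : List (Gen C)) (T : Set (List (Gen C))),
    Ax C s T → Ax D (s.map (map h)) (List.map (map h) '' T)

namespace GeometricTheory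

variable (T : GeometricTheory.{u, w} P)

/-- Sets of finite conjunctions at stage `C` that are closed under passing to stronger
conjunctions and under the axioms of the theory (stabilised under conjunction): if
`⋀ s ⊢ ⋁ {⋀ t | t ∈ V}` is an axiom and `k ∧ ⋀ t` is in the set for all `t ∈ V`, then so is
`k ∧ ⋀ s`. -/
structure IsIdeal (C : P) (I : Set (List (T.Gen C))) : Prop where
  lower : ∀ l l' : List (T.Gen C), l ⊆ l' → l ∈ I → l' ∈ I
  cover : ∀ (k s : List (T.Gen C)) (V : Set (List (T.Gen C))), T.Ax C s V →
    (∀ t ∈ V, k ++ t ∈ I) → k ++ s ∈ I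

/-- The ideal at stage `C` generated by a set of finite conjunctions. -/
def closure (C : P) (W : Set (List (T.Gen C))) : Set (List (T.Gen C)) :=
  {l | ∀ I : Set (List (T.Gen C)), T.IsIdeal C I → W ⊆ I → l ∈ I}

theorem subset_closure {C : P} (W : Set (List (T.Gen C))) : W ⊆ T.closure C W :=
  fun _ hl _ _ hW => hW hl

theorem closure_subset {C : P} {W I : Set (List (T.Gen C))} (hI : T.IsIdeal C I) (h : W ⊆ I) :
    T.closure C W ⊆ I := fun _ hl => hl I hI h

theorem isIdeal_closure (C : P) (W : Set (List (T.Gen C))) : T.IsIdeal C (T.closure C W) where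
  lower l l' h hl I hI hW := hI.lower l l' h (hl I hI hW)
  cover k s V hV hk I hI hW := hI.cover k s V hV fun t ht => hk t ht I hI hW

theorem isIdeal_preimage {C D : P} (h : C ≤ D) {I : Set (List (T.Gen D))} (hI : T.IsIdeal D I) :
    T.IsIdeal C (List.map (T.map h) ⁻¹' I) where
  lower l l' hl hm := hI.lower _ _ (List.map_subset _ hl) hm
  cover k s V hV hk := by
    rw [Set.mem_preimage, List.map_append]
    refine hI.cover _ _ _ (T.ax_map h s V hV) ?_
    rintro _ ⟨t, ht, rfl⟩
    simpa using hk t ht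

theorem map_mem_closure {C D : P} (h : C ≤ D) {W : Set (List (T.Gen C))}
    {W' : Set (List (T.Gen D))} (hW : ∀ l ∈ W, l.map (T.map h) ∈ T.closure D W')
    {l : List (T.Gen C)} (hl : l ∈ T.closure C W) : l.map (T.map h) ∈ T.closure D W' :=
  T.closure_subset (T.isIdeal_preimage h (T.isIdeal_closure D W')) hW hl

theorem list_map_refl {C : P} (l : List (T.Gen C)) : l.map (T.map (le_refl C)) = l := by
  induction l with
  | nil => rfl
  | cons x l ih => rw [List.map_cons, ih, T.map_refl]

theorem list_map_trans {C D E : P} (h : C ≤ D) (k : D ≤ E) (l : List (T.Gen C)) :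
    (l.map (T.map h)).map (T.map k) = l.map (T.map (h.trans k)) := by
  rw [List.map_map]
  exact List.map_congr_left fun x _ => T.map_trans h k x

/-- The elements at stage `C` of the frame presented by the theory: the subfunctors of
`D ↦ List (Gen D)`, restricted to the stages `D ≥ C`, whose values are ideals. -/
@[ext]
structure Open (C : P) where
  carrier : ∀ D : P, C ≤ D → Set (List (T.Gen D))
  isIdeal : ∀ (D : P) (h : C ≤ D), T.IsIdeal D (carrier D h)
  map_mem : ∀ {D E : P} (h : C ≤ D) (k : D ≤ E) (l : List (T.Gen D)),
    l ∈ carrier D h → l.map (T.map k) ∈ carrier E (h.trans k)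

namespace Open

variable {T} {C : P}

instance : PartialOrder (T.Open C) where
  le U V := ∀ (D : P) (h : C ≤ D), U.carrier D h ⊆ V.carrier D h
  le_refl _ _ _ := subset_rfl
  le_trans _ _ _ h k D hD := (h D hD).trans (k D hD)
  le_antisymm U V h k := by
    ext D hD l
    exact ⟨fun hl => h D hD hl, fun hl => k D hD hl⟩

instance : SemilatticeInf (T.Open C) where
  inf U V :=
    { carrier := fun D h => U.carrier D h ∩ V.carrier D h
      isIdeal := fun D h =>
        ⟨fun l l' hl hm => ⟨(U.isIdeal D h).lower l l' hl hm.1,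
            (V.isIdeal D h).lower l l' hl hm.2⟩,
          fun k s W hW hk => ⟨(U.isIdeal D h).cover k s W hW fun t ht => (hk t ht).1,
            (V.isIdeal D h).cover k s W hW fun t ht => (hk t ht).2⟩⟩
      map_mem := fun h k l hl => ⟨U.map_mem h k l hl.1, V.map_mem h k l hl.2⟩ }
  inf_le_left _ _ _ _ := Set.inter_subset_left
  inf_le_right _ _ _ _ := Set.inter_subset_right
  le_inf _ _ _ h k D hD := Set.subset_inter (h D hD) (k D hD)

instance : OrderTop (T.Open C) where
  top :=
    { carrier := fun _ _ => Set.univ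
      isIdeal := fun _ _ => ⟨fun _ _ _ _ => trivial, fun _ _ _ _ _ => trivial⟩
      map_mem := fun _ _ _ _ => trivial }
  le_top _ _ _ := Set.subset_univ _

/-- Truncation of an element at stage `C` to the stages beyond `D ≥ C`. -/
def res {D : P} (h : C ≤ D) : InfTopHom (T.Open C) (T.Open D) where
  toFun U :=
    { carrier := fun E k => U.carrier E (h.trans k)
      isIdeal := fun E k => U.isIdeal E (h.trans k)
      map_mem := fun k k' l hl => U.map_mem (h.trans k) k' l hl }
  map_inf' _ _ := rfl
  map_top' := rfl

end Open

/-- The internal meet semilattice underlying the frame presented by the theory. -/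
abbrev semilattice : InternalSemilattice.{u, max u w} P where
  obj := T.Open
  res := Open.res
  res_refl _ := rfl
  res_trans _ _ _ := rfl

/-- The join of an internal set of elements: at each stage, the ideal generated by the union. -/
def join {C : P} (S : InternalSubset T.semilattice C) : T.Open C where
  carrier D h := T.closure D {l | ∃ U : T.Open D, U ∈ S.carrier D h ∧ l ∈ U.carrier D le_rfl}
  isIdeal D h := T.isIdeal_closure D _
  map_mem := by
    intro D E h k l hl
    refine T.map_mem_closure k ?_ hl
    rintro l ⟨U, hU, hl⟩
    exact T.subset_closure _ ⟨Open.res k U, S.res_mem h k U hU, U.map_mem le_rfl k l hl⟩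

theorem isJoin_join {C : P} (S : InternalSubset T.semilattice C) : S.IsJoin (T.join S) := by
  intro D h y
  constructor
  · intro hy E k z hz E' k' l hl
    refine hy E' (k.trans k') (T.subset_closure _ ⟨Open.res k' z, S.res_mem _ k' z hz, hl⟩)
  · intro hy E k
    refine T.closure_subset (y.isIdeal E k) ?_
    rintro l ⟨U, hU, hl⟩
    exact hy E k U hU E le_rfl hl

theorem meet_isJoin {C : P} (x : T.Open C) (S : InternalSubset T.semilattice C) (b : T.Open C)
    (hb : S.IsJoin b) : InternalSubset.IsJoin (F := T.semilattice)
      (InternalSubset.meet (F := T.semilattice) x S) (x ⊓ b : T.Open C) := by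
  intro D h y
  constructor
  · rintro hy E k _ ⟨z, hz, rfl⟩ E' k' l ⟨hl, hl'⟩
    refine hy E' (k.trans k') ⟨hl, ?_⟩
    exact (hb E (h.trans k) (Open.res (h.trans k) b)).1 le_rfl E le_rfl z hz E' k' hl'
  · rintro hy E k l ⟨hlx, hlb⟩
    -- the ideal of all conjunctions whose conjunction with `l` lies in `y`
    have hI : T.IsIdeal E {m | l ++ m ∈ y.carrier E k} :=
      ⟨fun m m' hm hlm => (y.isIdeal E k).lower _ _
          (List.append_subset.2 ⟨List.subset_append_left _ _,
            List.Subset.trans hm (List.subset_append_right _ _)⟩) hlm,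
        fun m s V hV hm => by
          have := (y.isIdeal E k).cover (l ++ m) s V hV fun t ht => by
            simpa using hm t ht
          simpa using this⟩
    have hbj : Open.carrier b E (h.trans k) ⊆ (T.join S).carrier E (h.trans k) := by
      have : (b : T.Open C) ≤ T.join S := by
        refine (hb C le_rfl (T.join S)).2 fun E' k' z hz => ?_
        exact (T.isJoin_join S E' k' (Open.res k' (T.join S))).1 le_rfl E' le_rfl z hz
      exact this E (h.trans k)
    have : l ++ l ∈ y.carrier E k := by
      refine T.closure_subset hI ?_ (hbj hlb)
      rintro m ⟨U, hU, hm⟩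
      refine hy E k _ ⟨U, hU, rfl⟩ E le_rfl ⟨?_, ?_⟩
      · exact (x.isIdeal E (h.trans k)).lower l _ (List.subset_append_left _ _) hlx
      · exact (U.isIdeal E le_rfl).lower m _ (List.subset_append_right _ _) hm
    exact (y.isIdeal E k).lower _ _ (List.append_subset.2 ⟨fun _ h => h, fun _ h => h⟩) this

/-- The internal frame freely generated by the atomic propositions of the theory, subject to
its axioms. -/
abbrev frame : InternalFrame.{u, max u w} P where
  toInternalSemilattice := T.semilattice
  join := T.join
  isJoin_join := T.isJoin_join
  meet_isJoin := T.meet_isJoin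

/-- The element of the presented frame given by an atomic proposition. -/
def gen {C : P} (g : T.Gen C) : T.frame.obj C :=
  { carrier := fun D h => T.closure D {[T.map h g]}
    isIdeal := fun D _ => T.isIdeal_closure D _
    map_mem := fun {D E} h k l hl => by
      refine T.map_mem_closure k ?_ hl
      rintro _ rfl
      refine T.subset_closure _ ?_
      simp [T.map_trans] : T.Open C }

/-- An interpretation of the theory in an internal frame: a natural transformation from the atomic
propositions to the frame under which all axioms hold. -/
structure Model (F : InternalFrame.{u, v} P) where
  val : ∀ {C : P}, T.Gen C → F.obj C
  naturality : ∀ {C D : P} (h : C ≤ D) (g : T.Gen C), val (T.map h g) = F.res h (val g)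
  sound : ∀ {C : P} (s : List (T.Gen C)) (V : Set (List (T.Gen C))), T.Ax C s V →
    ∀ y : F.obj C, (∀ t ∈ V, t.foldr (fun g x => val g ⊓ x) ⊤ ≤ y) →
      s.foldr (fun g x => val g ⊓ x) ⊤ ≤ y

namespace Model

variable {T} {F : InternalFrame.{u, v} P} (M : T.Model F)

/-- The value of a finite conjunction. -/
def conj {C : P} (l : List (T.Gen C)) : F.obj C := l.foldr (fun g x => M.val g ⊓ x) ⊤

theorem conj_cons {C : P} (g : T.Gen C) (l : List (T.Gen C)) :
    M.conj (g :: l) = M.val g ⊓ M.conj l := rfl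

theorem conj_singleton {C : P} (g : T.Gen C) : M.conj [g] = M.val g := inf_top_eq _

theorem conj_append {C : P} (l l' : List (T.Gen C)) :
    M.conj (l ++ l') = M.conj l ⊓ M.conj l' := by
  induction l with
  | nil => exact (top_inf_eq _).symm
  | cons g l ih => rw [List.cons_append, conj_cons, conj_cons, ih, inf_assoc]

theorem conj_le {C : P} {l : List (T.Gen C)} {g : T.Gen C} (hg : g ∈ l) :
    M.conj l ≤ M.val g := by
  induction l with
  | nil => simp at hg
  | cons g' l ih =>
    rw [conj_cons]
    rcases List.mem_cons.1 hg with rfl | hg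
    · exact inf_le_left
    · exact inf_le_right.trans (ih hg)

theorem conj_anti {C : P} {l l' : List (T.Gen C)} (h : l ⊆ l') : M.conj l' ≤ M.conj l := by
  induction l with
  | nil => exact le_top
  | cons g l ih =>
    rw [conj_cons]
    exact le_inf (M.conj_le (h List.mem_cons_self)) (ih fun x hx => h (List.mem_cons_of_mem _ hx))

theorem conj_map {C D : P} (h : C ≤ D) (l : List (T.Gen C)) :
    M.conj (l.map (T.map h)) = F.res h (M.conj l) := by
  induction l with
  | nil => exact (map_top (F.res h)).symm
  | cons g l ih => rw [List.map_cons, conj_cons, conj_cons, ih, M.naturality, map_inf]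

theorem conj_cover {C : P} (k s : List (T.Gen C)) (V : Set (List (T.Gen C))) (hV : T.Ax C s V)
    (y : F.obj C) (hy : ∀ t ∈ V, M.conj (k ++ t) ≤ y) : M.conj (k ++ s) ≤ y := by
  let S : F.Subset C :=
    { carrier := fun D h => {x | ∃ t ∈ V, x = F.res h (M.conj t)}
      res_mem := by
        rintro D E h k _ ⟨t, ht, rfl⟩
        exact ⟨t, ht, F.res_trans h k _⟩ }
  have hS := F.isJoin_join S
  have h1 : M.conj s ≤ F.join S := by
    refine M.sound s V hV _ fun t ht => ?_
    have := hS.le le_rfl (z := M.conj t) ⟨t, ht, (F.res_refl _).symm⟩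
    rwa [F.res_refl] at this
  have h2 : M.conj k ⊓ F.join S ≤ y := by
    refine ((F.meet_isJoin (M.conj k) S _ hS).le_iff' y).2 ?_
    rintro E h _ ⟨_, ⟨t, ht, rfl⟩, rfl⟩
    rw [← map_inf, ← conj_append]
    exact OrderHomClass.mono (F.res h) (hy t ht)
  rw [conj_append]
  exact (inf_le_inf_left _ h1).trans h2

/-- The internal set of values of the conjunctions that belong to an element of the presented
frame. -/
def image {C : P} (U : T.Open C) : F.Subset C where
  carrier D h := {x | ∃ l ∈ U.carrier D h, x = M.conj l}
  res_mem := by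
    rintro D E h k _ ⟨l, hl, rfl⟩
    exact ⟨_, U.map_mem h k l hl, (M.conj_map k l).symm⟩

/-- The element of the presented frame that consists of all conjunctions below `y`. -/
def below {C : P} (y : F.obj C) : T.Open C where
  carrier D h := {l | M.conj l ≤ F.res h y}
  isIdeal D h := ⟨fun _ _ hl hy => (M.conj_anti hl).trans hy,
    fun k s V hV hk => M.conj_cover k s V hV _ hk⟩
  map_mem := by
    intro D E h k l hl
    change M.conj _ ≤ _
    rw [conj_map, ← F.res_trans h k]
    exact OrderHomClass.mono (F.res k) hl

theorem join_image_le {C : P} (U : T.Open C) (y : F.obj C) :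
    F.join (M.image U) ≤ y ↔ U ≤ M.below y := by
  rw [(F.isJoin_join (M.image U)).le_iff']
  constructor
  · intro h D k l hl
    exact h D k _ ⟨l, hl, rfl⟩
  · rintro h D k _ ⟨l, hl, rfl⟩
    exact h D k hl

theorem res_join_image {C D : P} (h : C ≤ D) (U : T.Open C) :
    F.res h (F.join (M.image U)) = F.join (M.image (Open.res h U)) := by
  refine eq_of_forall_ge_iff fun y => ?_
  rw [(F.isJoin_join (M.image U)).le_iff h, (F.isJoin_join (M.image (Open.res h U))).le_iff']
  rfl

theorem conj_le_join {C D : P} (h : C ≤ D) (U : T.Open C) {l : List (T.Gen D)}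
    (hl : l ∈ U.carrier D h) : M.conj l ≤ F.res h (F.join (M.image U)) :=
  (F.isJoin_join (M.image U)).le h ⟨l, hl, rfl⟩

theorem mono_join {C : P} {U V : T.Open C} (h : U ≤ V) :
    F.join (M.image U) ≤ F.join (M.image V) :=
  (M.join_image_le U _).2 (h.trans ((M.join_image_le V _).1 le_rfl))

/-- The map of internal frames, from the frame presented by the theory, that is induced by a
model. -/
def lift : InternalFrameHom T.frame F where
  app C :=
    { toFun := fun U => F.join (M.image (C := C) U)
      map_inf' := by
        intro U V
        refine le_antisymm (le_inf (M.mono_join inf_le_left) (M.mono_join inf_le_right)) ?_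
        rw [inf_comm]
        refine ((F.meet_isJoin _ _ _ (F.isJoin_join (M.image U))).le_iff' _).2 ?_
        rintro D h _ ⟨_, ⟨l, hl, rfl⟩, rfl⟩
        rw [res_join_image, res_join_image, inf_comm]
        refine ((F.meet_isJoin _ _ _ (F.isJoin_join (M.image _))).le_iff' _).2 ?_
        rintro E k _ ⟨_, ⟨l', hl', rfl⟩, rfl⟩
        rw [← conj_map, ← conj_append, res_join_image]
        have := M.conj_le_join (le_refl E) (Open.res k (Open.res h (U ⊓ V : T.Open C)))
          (l := l.map (T.map k) ++ l')
          ⟨(U.isIdeal E _).lower _ _ (List.subset_append_left _ _) (U.map_mem h k l hl),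
            (V.isIdeal E _).lower _ _ (List.subset_append_right _ _) hl'⟩
        rwa [F.res_refl] at this
      map_top' := by
        refine top_le_iff.1 ?_
        have := M.conj_le_join (le_refl C) ⊤ (l := []) trivial
        rwa [F.res_refl] at this }
  naturality h U := (M.res_join_image h U).symm
  map_isJoin := by
    intro C S b hb
    refine InternalSubset.IsJoin.of_le ?_ ?_
    · rintro E k _ ⟨U, hU, rfl⟩
      change F.join (M.image U) ≤ F.res k (F.join (M.image b))
      rw [res_join_image]
      exact M.mono_join (hb.le k hU)
    · intro D h y hy
      change F.res h (F.join (M.image b)) ≤ y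
      rw [res_join_image, join_image_le]
      refine (hb.le_iff h _).2 fun E k U hU => ?_
      intro E' k' l hl
      have := (M.join_image_le U _).1 (hy E k _ ⟨U, hU, rfl⟩) E' k' hl
      change M.conj l ≤ F.res (k.trans k') y
      rw [← F.res_trans k k']
      exact this

theorem lift_gen {C : P} (g : T.Gen C) : M.lift.app C (T.gen g) = M.val g := by
  refine eq_of_forall_ge_iff fun y => ?_
  refine (M.join_image_le (T.gen g) y).trans ?_
  constructor
  · intro h
    have := h C le_rfl (T.subset_closure _ (Set.mem_singleton _))
    have h2 : M.conj [T.map (le_refl C) g] ≤ F.res (le_refl C) y := this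
    rwa [T.map_refl, conj_singleton, F.res_refl] at h2
  · intro h D k
    refine T.closure_subset ((M.below y).isIdeal D k) ?_
    rintro _ rfl
    change M.conj _ ≤ F.res k y
    rw [conj_singleton, M.naturality]
    exact OrderHomClass.mono (F.res k) h

end Model

theorem gen_map {C D : P} (h : C ≤ D) (g : T.Gen C) :
    (T.gen (T.map h g) : T.frame.obj D) = T.frame.res h (T.gen g) := by
  refine Open.ext ?_
  funext E k
  change T.closure E {[T.map k (T.map h g)]} = T.closure E {[T.map (h.trans k) g]}
  rw [T.map_trans]

theorem mem_of_mem_conj {C D : P} (h : C ≤ D) {I : Set (List (T.Gen D))} (hI : T.IsIdeal D I)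
    (l : List (T.Gen C)) : ∀ m k : List (T.Gen D),
      m ∈ Open.carrier (l.foldr (fun g x => T.gen g ⊓ x) (⊤ : T.Open C)) D h →
      l.map (T.map h) ++ k ∈ I → m ++ k ∈ I := by
  induction l with
  | nil => exact fun m k _ hk => hI.lower _ _ (List.subset_append_right _ _) hk
  | cons g l ih =>
    rintro m k ⟨hm, hm'⟩ hk
    have hJ : T.IsIdeal D {n | l.map (T.map h) ++ k ++ n ∈ I} :=
      ⟨fun n n' hn hln => hI.lower _ _ (List.append_subset.2 ⟨List.subset_append_left _ _,
          List.Subset.trans hn (List.subset_append_right _ _)⟩) hln,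
        fun n s V hV hn => by
          have := hI.cover (l.map (T.map h) ++ k ++ n) s V hV fun t ht => by
            simpa using hn t ht
          simpa using this⟩
    have h1 : l.map (T.map h) ++ k ++ m ∈ I := by
      refine T.closure_subset hJ ?_ hm
      rintro _ rfl
      refine hI.lower _ _ ?_ hk
      intro x hx
      simp only [List.map_cons, List.mem_append, List.mem_cons, List.not_mem_nil, or_false] at hx ⊢
      tauto
    rw [List.append_assoc] at h1
    refine hI.lower _ _ ?_ (ih m (k ++ m) hm' h1)
    intro x hx
    simp only [List.mem_append] at hx ⊢
    tauto

theorem map_mem_conj {C D : P} (h : C ≤ D) (l : List (T.Gen C)) :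
    l.map (T.map h) ∈ Open.carrier (l.foldr (fun g x => T.gen g ⊓ x) (⊤ : T.Open C)) D h := by
  induction l with
  | nil => trivial
  | cons g l ih =>
    refine ⟨(T.isIdeal_closure D _).lower [T.map h g] _ (by simp)
      (T.subset_closure _ (Set.mem_singleton _)), ?_⟩
    exact (Open.isIdeal _ D h).lower _ _ (by simp) ih

/-- The axioms of the theory hold in the frame that it presents. -/
theorem gen_sound {C : P} (s : List (T.Gen C)) (V : Set (List (T.Gen C))) (hV : T.Ax C s V)
    (y : T.frame.obj C) (hy : ∀ t ∈ V, t.foldr (fun g x => T.gen g ⊓ x) ⊤ ≤ y) :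
    s.foldr (fun g x => T.gen g ⊓ x) ⊤ ≤ y := by
  intro D h m hm
  have h1 : s.map (T.map h) ∈ Open.carrier y D h := by
    refine (Open.isIdeal y D h).cover [] _ _ (T.ax_map h s V hV) ?_
    rintro _ ⟨t, ht, rfl⟩
    exact hy t ht D h (T.map_mem_conj h t)
  have := T.mem_of_mem_conj h (Open.isIdeal y D h) s m [] hm (by simpa using h1)
  simpa using this

/-- The generic model, in the frame presented by the theory. -/
def genericModel : T.Model T.frame where
  val g := T.gen g
  naturality := T.gen_map
  sound := T.gen_sound

end GeometricTheory

/-! ## The internal interval domain -/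

/-- Open intervals `(p, q)` with rational end points `p < q`. -/
def RatInterval : Type := {x : ℚ × ℚ // x.1 < x.2}

/-- The interval `(p, q)`. -/
def RatInterval.mk (p q : ℚ) (h : p < q) : RatInterval := ⟨(p, q), h⟩

/-- The left end point. -/
def RatInterval.lo (x : RatInterval) : ℚ := x.1.1

/-- The right end point. -/
def RatInterval.hi (x : RatInterval) : ℚ := x.1.2

theorem RatInterval.lo_lt_hi (x : RatInterval) : x.lo < x.hi := x.2

/-- The axioms of the theory of the interval domain: those of the Dedekind reals without
`(p, q) = (p, q₁) ∨ (p₁, q)` for `p ≤ p₁ ≤ q₁ ≤ q`. -/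
inductive IntervalAx : List RatInterval → Set (List RatInterval) → Prop
  /-- `(p₁,q₁) ∧ (p₂,q₂) ≤ (max p₁ p₂, min q₁ q₂)` if the latter is an interval -/
  | meet_le (x y : RatInterval) (h : max x.lo y.lo < min x.hi y.hi) :
      IntervalAx [x, y] {[RatInterval.mk _ _ h]}
  /-- `(max p₁ p₂, min q₁ q₂) ≤ (p₁,q₁) ∧ (p₂,q₂)` -/
  | le_meet (x y : RatInterval) (h : max x.lo y.lo < min x.hi y.hi) :
      IntervalAx [RatInterval.mk _ _ h] {[x, y]}
  /-- `(p₁,q₁) ∧ (p₂,q₂) = ⊥` otherwise -/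
  | disjoint (x y : RatInterval) (h : ¬ max x.lo y.lo < min x.hi y.hi) : IntervalAx [x, y] ∅
  /-- `(p,q) ≤ ⋁ {(p',q') | p < p' < q' < q}` -/
  | le_join (x : RatInterval) :
      IntervalAx [x] {l | ∃ y : RatInterval, x.lo < y.lo ∧ y.hi < x.hi ∧ l = [y]}
  /-- `(p',q') ≤ (p,q)` if `p < p' < q' < q` -/
  | join_le (x y : RatInterval) (h : x.lo < y.lo) (h' : y.hi < x.hi) : IntervalAx [y] {[x]}
  /-- `⊤ = ⋁ {(p,q) | p < q}` -/
  | top : IntervalAx [] {l | ∃ x : RatInterval, l = [x]}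

/-- The theory of the interval domain, interpreted in `Sets^P`; its atomic propositions form the
constant functor. -/
abbrev intervalTheory (P : Type u) [Preorder P] : GeometricTheory.{u, 0} P where
  Gen _ := RatInterval
  map _ := id
  map_refl _ := rfl
  map_trans _ _ _ := rfl
  Ax _ := IntervalAx
  ax_map := by
    intro C D h s T hT
    have : (List.map id : List RatInterval → List RatInterval) = id := by
      funext l; simp
    rwa [this, Set.image_id, id]

/-- The frame of the internal interval domain in `Sets^P`. -/
abbrev intervalDomain (P : Type u) [Preorder P] : InternalFrame.{u, u} P :=
  (intervalTheory P).frame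

/-- The open `(r, s)` of the internal interval domain. -/
def ioo (C : P) (x : RatInterval) : (intervalDomain P).obj C := (intervalTheory P).gen (C := C) x

theorem res_ioo {C D : P} (h : C ≤ D) (x : RatInterval) :
    (intervalDomain P).res h (ioo C x) = ioo D x :=
  ((intervalTheory P).gen_map (C := C) h x).symm

/-- The open `(r, ∞)`, the join of the `(r, s)` with `s > r`. -/
def ioi (C : P) (r : ℚ) : (intervalDomain P).obj C :=
  (intervalDomain P).join
    { carrier := fun D _ => {y | ∃ x : RatInterval, x.lo = r ∧ y = ioo D x}
      res_mem := by
        rintro D E _ k _ ⟨x, hx, rfl⟩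
        exact ⟨x, hx, res_ioo k x⟩ }

/-- The open `(-∞, s)`, the join of the `(r, s)` with `r < s`. -/
def iio (C : P) (s : ℚ) : (intervalDomain P).obj C :=
  (intervalDomain P).join
    { carrier := fun D _ => {y | ∃ x : RatInterval, x.hi = s ∧ y = ioo D x}
      res_mem := by
        rintro D E _ k _ ⟨x, hx, rfl⟩
        exact ⟨x, hx, res_ioo k x⟩ }

/-- The pointwise order on locale maps into the interval domain, where intervals are compared by
`[x, y] ≤ [x', y'] ↔ x ≤ x' ∧ y ≤ y'`.  In terms of opens: the lower end point grows and so does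
the upper end point.  (For exact values `x = y`, this is the order of real functions; it is not
the information order by reverse inclusion.) -/
instance (X : InternalFrame.{u, v} P) : LE (LocaleMap X (intervalDomain P)) where
  le φ ψ := ∀ C : P,
    (∀ r : ℚ, φ.inverseImage.app C (ioi C r) ≤ ψ.inverseImage.app C (ioi C r)) ∧
    (∀ s : ℚ, ψ.inverseImage.app C (iio C s) ≤ φ.inverseImage.app C (iio C s))

/-! ## The contexts of a C*-algebra and the internal Gelfand spectrum -/

section CStar

variable (A : Type u) [CStarAlgebra A]

/-- The poset of unital commutative C*-subalgebras of `A`, ordered by inclusion. -/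
def Context : Type u :=
  {C : StarSubalgebra ℂ A // IsClosed (C : Set A) ∧ ∀ x ∈ C, ∀ y ∈ C, x * y = y * x}

instance : PartialOrder (Context A) :=
  inferInstanceAs (PartialOrder
    {C : StarSubalgebra ℂ A // IsClosed (C : Set A) ∧ ∀ x ∈ C, ∀ y ∈ C, x * y = y * x})

variable {A}

/-- The self-adjoint elements of a context. -/
def Context.Sa (C : Context A) : Type u := {c : A // c ∈ C.1 ∧ IsSelfAdjoint c}

namespace Context.Sa

variable {C : Context A}

instance : CoeOut (Sa C) A := ⟨Subtype.val⟩

instance : One (Sa C) := ⟨⟨1, one_mem C.1, .one A⟩⟩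

instance : Neg (Sa C) := ⟨fun a => ⟨-a.1, neg_mem a.2.1, a.2.2.neg⟩⟩

instance : Add (Sa C) := ⟨fun a b => ⟨a.1 + b.1, add_mem a.2.1 b.2.1, a.2.2.add b.2.2⟩⟩

instance : Sub (Sa C) := ⟨fun a b => ⟨a.1 - b.1, sub_mem a.2.1 b.2.1, a.2.2.sub b.2.2⟩⟩

instance : Mul (Sa C) := ⟨fun a b => ⟨a.1 * b.1, mul_mem a.2.1 b.2.1,
  (a.2.2.commute_iff b.2.2).1 (C.2.2 _ a.2.1 _ b.2.1)⟩⟩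

/-- The rational multiples of the unit. -/
noncomputable instance : RatCast (Sa C) := ⟨fun r => ⟨algebraMap ℂ A r, C.1.algebraMap_mem r, by
  rw [IsSelfAdjoint, ← algebraMap_star_comm]; simp⟩⟩

/-- The inclusion of the self-adjoint part of a context into that of a larger context. -/
def incl {C D : Context A} (h : C ≤ D) (a : Sa C) : Sa D := ⟨a.1, h a.2.1, a.2.2⟩

end Context.Sa

/-- The relations between the symbols `D_a`, `a` self-adjoint in the context `C`, that define the
Gelfand spectrum. -/
inductive SpectrumAx (C : Context A) : List C.Sa → Set (List C.Sa) → Prop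
  /-- `D_1 = ⊤` -/
  | one : SpectrumAx C [] {[1]}
  /-- `D_a ∧ D_{-a} = ⊥` -/
  | neg (a : C.Sa) : SpectrumAx C [a, -a] ∅
  /-- `D_{-b²} = ⊥` -/
  | neg_sq (b : C.Sa) : SpectrumAx C [-(b * b)] ∅
  /-- `D_{a+b} ≤ D_a ∨ D_b` -/
  | add (a b : C.Sa) : SpectrumAx C [a + b] {[a], [b]}
  /-- `D_{ab} ≤ (D_a ∧ D_b) ∨ (D_{-a} ∧ D_{-b})` -/
  | mul_le (a b : C.Sa) : SpectrumAx C [a * b] {[a, b], [-a, -b]}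
  /-- `D_a ∧ D_b ≤ D_{ab}` -/
  | le_mul (a b : C.Sa) : SpectrumAx C [a, b] {[a * b]}
  /-- `D_{-a} ∧ D_{-b} ≤ D_{ab}` -/
  | neg_le_mul (a b : C.Sa) : SpectrumAx C [-a, -b] {[a * b]}
  /-- `D_a ≤ ⋁ {D_{a-r} | r > 0 rational}` -/
  | regular (a : C.Sa) : SpectrumAx C [a] {l | ∃ r : ℚ, 0 < r ∧ l = [a - (r : C.Sa)]}

variable (A)

/-- The theory of the Gelfand spectrum of the internal commutative C*-algebra `C ↦ C` in the topos
of functors on the contexts of `A`. -/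
abbrev spectrumTheory : GeometricTheory.{u, u} (Context A) where
  Gen C := C.Sa
  map h := Context.Sa.incl h
  map_refl _ := rfl
  map_trans _ _ _ := rfl
  Ax := SpectrumAx
  ax_map := by
    rintro C D h _ _ (_ | a | b | ⟨a, b⟩ | ⟨a, b⟩ | ⟨a, b⟩ | ⟨a, b⟩ | a)
    · rw [Set.image_singleton]; exact .one
    · rw [Set.image_empty]; exact .neg (Context.Sa.incl h a)
    · rw [Set.image_empty]; exact .neg_sq (Context.Sa.incl h b)
    · rw [Set.image_pair]; exact .add (Context.Sa.incl h a) (Context.Sa.incl h b)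
    · rw [Set.image_pair]; exact .mul_le (Context.Sa.incl h a) (Context.Sa.incl h b)
    · rw [Set.image_singleton]; exact .le_mul (Context.Sa.incl h a) (Context.Sa.incl h b)
    · rw [Set.image_singleton]; exact .neg_le_mul (Context.Sa.incl h a) (Context.Sa.incl h b)
    · have : List.map (Context.Sa.incl h) '' {l | ∃ r : ℚ, 0 < r ∧ l = [a - (r : C.Sa)]} =
          {l | ∃ r : ℚ, 0 < r ∧ l = [Context.Sa.incl h a - (r : D.Sa)]} := by
        ext l
        constructor
        · rintro ⟨_, ⟨r, hr, rfl⟩, rfl⟩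
          exact ⟨r, hr, rfl⟩
        · rintro ⟨r, hr, rfl⟩
          exact ⟨_, ⟨r, hr, rfl⟩, rfl⟩
      rw [this]
      exact .regular (Context.Sa.incl h a)

/-- The frame of the Gelfand spectrum of the internal C*-algebra `C ↦ C`. -/
abbrev gelfandSpectrum : InternalFrame.{u, u} (Context A) := (spectrumTheory A).frame

variable {A}

/-- The open `D_a` of the internal spectrum, for `a` self-adjoint in the context `C`. -/
def basicOpen {C : Context A} (a : C.Sa) : (gelfandSpectrum A).obj C :=
  (spectrumTheory A).gen (C := C) a

theorem res_basicOpen {C D : Context A} (h : C ≤ D) (a : C.Sa) :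
    (gelfandSpectrum A).res h (basicOpen a) = basicOpen (a.incl h) :=
  ((spectrumTheory A).gen_map (C := C) h a).symm

theorem basicOpen_sound {C : Context A} {s : List C.Sa} {V : Set (List C.Sa)}
    (hV : SpectrumAx C s V) (y : (gelfandSpectrum A).obj C)
    (hy : ∀ t ∈ V, t.foldr (fun g x => basicOpen g ⊓ x) ⊤ ≤ y) :
    s.foldr (fun g x => basicOpen g ⊓ x) ⊤ ≤ y :=
  (spectrumTheory A).gen_sound (C := C) s V hV y hy

section Relations

variable {C : Context A}

theorem le_basicOpen_of_eq_one {u : C.Sa} (hu : u.1 = 1) : ⊤ ≤ basicOpen u := by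
  obtain rfl : u = 1 := Subtype.ext hu
  exact basicOpen_sound (.one) _ (by simp)

theorem basicOpen_inf_neg (a : C.Sa) (y : (gelfandSpectrum A).obj C) :
    basicOpen a ⊓ basicOpen (-a) ≤ y := by
  simpa using basicOpen_sound (.neg a) y (by simp)

theorem basicOpen_neg_sq (b : C.Sa) (y : (gelfandSpectrum A).obj C) :
    basicOpen (-(b * b)) ≤ y := by
  simpa using basicOpen_sound (.neg_sq b) y (by simp)

theorem basicOpen_add_le (a b : C.Sa) (y : (gelfandSpectrum A).obj C) (ha : basicOpen a ≤ y)
    (hb : basicOpen b ≤ y) : basicOpen (a + b) ≤ y := by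
  simpa using basicOpen_sound (.add a b) y (by simp [ha, hb])

theorem inf_basicOpen_le_of_forall (b a : C.Sa) (y : (gelfandSpectrum A).obj C)
    (h : ∀ r : ℚ, 0 < r → basicOpen b ⊓ basicOpen (a - (r : C.Sa)) ≤ y) :
    basicOpen b ⊓ basicOpen a ≤ y := by
  have := (spectrumTheory A).genericModel.conj_cover (C := C) [b] [a] _ (.regular a) y (by
    rintro _ ⟨r, hr, rfl⟩
    refine le_trans (le_of_eq ?_) (h r hr)
    exact congrArg (basicOpen b ⊓ ·) (inf_top_eq _))
  refine le_trans (le_of_eq ?_) this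
  exact congrArg (basicOpen b ⊓ ·) (inf_top_eq _).symm

variable [PartialOrder A] [StarOrderedRing A]

theorem basicOpen_mono {f g : C.Sa} (h : f.1 ≤ g.1) : basicOpen f ≤ basicOpen g := by
  have h0 : 0 ≤ g.1 - f.1 := sub_nonneg.2 h
  have hmem : CFC.sqrt (g.1 - f.1) ∈ C.1 := by
    have : IsClosed (C.1 : Set A) := C.2.1
    rw [CFC.sqrt_eq_real_sqrt _ h0, cfcₙ_eq_cfc]
    exact cfc_mem (𝕜' := ℂ) Real.sqrt (sub_mem g.2.1 f.2.1)
  let b : C.Sa := ⟨CFC.sqrt (g.1 - f.1), hmem, .of_nonneg (CFC.sqrt_nonneg _)⟩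
  have : f = g + -(b * b) := Subtype.ext <| by
    change f.1 = g.1 + -(CFC.sqrt (g.1 - f.1) * CFC.sqrt (g.1 - f.1))
    rw [CFC.sqrt_mul_sqrt_self _ h0]
    abel
  rw [this]
  exact basicOpen_add_le _ _ _ le_rfl (basicOpen_neg_sq _ _)

theorem ratCast_mono {r s : ℚ} (h : r ≤ s) : (r : C.Sa).1 ≤ (s : C.Sa).1 := by
  change algebraMap ℂ A r ≤ algebraMap ℂ A s
  have e : ∀ q : ℚ, algebraMap ℂ A q = algebraMap ℝ A q := fun q => by
    rw [IsScalarTower.algebraMap_apply ℝ ℂ A]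
    simp
  rw [e, e]
  exact algebraMap_mono A (by exact_mod_cast h)

theorem basicOpen_disjoint {f g : C.Sa} (h : f.1 ≤ g.1) {r s : ℚ} (hrs : s ≤ r)
    (y : (gelfandSpectrum A).obj C) :
    basicOpen (f - (r : C.Sa)) ⊓ basicOpen ((s : C.Sa) - g) ≤ y := by
  refine le_trans (inf_le_inf_left _ (basicOpen_mono (g := -(f - (r : C.Sa))) ?_))
    (basicOpen_inf_neg _ y)
  change (s : C.Sa).1 - g.1 ≤ -(f.1 - (r : C.Sa).1)
  rw [neg_sub]
  exact sub_le_sub (ratCast_mono hrs) h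

end Relations

/-! ## Daseinisation -/

section Approximants

variable [PartialOrder A]

/-- The internal set of all `D_{f-r} ∧ D_{s-g}`, where `f ≤ a ≤ g` and where `f` and `g` are
self-adjoint elements of the internal C*-algebra. -/
def approximants (a : selfAdjoint A) (C : Context A) (r s : ℚ) : (gelfandSpectrum A).Subset C where
  carrier D _ := {x | ∃ f g : D.Sa, f.1 ≤ (a : A) ∧ (a : A) ≤ g.1 ∧
    x = basicOpen (f - (r : D.Sa)) ⊓ basicOpen ((s : D.Sa) - g)}
  res_mem := by
    rintro D E _ k _ ⟨f, g, hf, hg, rfl⟩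
    exact ⟨f.incl k, g.incl k, hf, hg, by rw [map_inf, res_basicOpen, res_basicOpen]; rfl⟩

theorem le_join_approximants {a : selfAdjoint A} {C D : Context A} {r s : ℚ} (h : C ≤ D)
    {f g : D.Sa} (hf : f.1 ≤ (a : A)) (hg : (a : A) ≤ g.1) :
    basicOpen (f - (r : D.Sa)) ⊓ basicOpen ((s : D.Sa) - g) ≤
      (gelfandSpectrum A).res h ((gelfandSpectrum A).join (approximants a C r s)) :=
  ((gelfandSpectrum A).isJoin_join (approximants a C r s)).le h ⟨f, g, hf, hg, rfl⟩

theorem exists_approximant (a : selfAdjoint A) {D : Context A} (r s r' s' : ℚ)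
    {f g f' g' : D.Sa} (hf : f.1 ≤ (a : A)) (hg : (a : A) ≤ g.1) (hf' : f'.1 ≤ (a : A))
    (hg' : (a : A) ≤ g'.1) : ∃ f₀ g₀ : D.Sa, f₀.1 ≤ (a : A) ∧ (a : A) ≤ g₀.1 ∧
      (basicOpen (f - (r : D.Sa)) ⊓ basicOpen ((s : D.Sa) - g)) ⊓
        (basicOpen (f' - (r' : D.Sa)) ⊓ basicOpen ((s' : D.Sa) - g')) ≤
      basicOpen (f₀ - ((max r r' : ℚ) : D.Sa)) ⊓ basicOpen (((min s s' : ℚ) : D.Sa) - g₀) := by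
  have h1 : ∃ f₀ : D.Sa, f₀.1 ≤ (a : A) ∧ basicOpen (f - (r : D.Sa)) ⊓
      basicOpen (f' - (r' : D.Sa)) ≤ basicOpen (f₀ - ((max r r' : ℚ) : D.Sa)) := by
    rcases le_total r r' with h | h
    · exact ⟨f', hf', by rw [max_eq_right h]; exact inf_le_right⟩
    · exact ⟨f, hf, by rw [max_eq_left h]; exact inf_le_left⟩
  have h2 : ∃ g₀ : D.Sa, (a : A) ≤ g₀.1 ∧ basicOpen ((s : D.Sa) - g) ⊓
      basicOpen ((s' : D.Sa) - g') ≤ basicOpen (((min s s' : ℚ) : D.Sa) - g₀) := by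
    rcases le_total s s' with h | h
    · exact ⟨g, hg, by rw [min_eq_left h]; exact inf_le_left⟩
    · exact ⟨g', hg', by rw [min_eq_right h]; exact inf_le_right⟩
  obtain ⟨f₀, hf₀, hf₁⟩ := h1
  obtain ⟨g₀, hg₀, hg₁⟩ := h2
  refine ⟨f₀, g₀, hf₀, hg₀, ?_⟩
  rw [inf_inf_inf_comm]
  exact inf_le_inf hf₁ hg₁

end Approximants

variable [PartialOrder A] [StarOrderedRing A]

theorem sub_ratCast_mono {C : Context A} (f : C.Sa) {r r' : ℚ} (h : r ≤ r') :
    basicOpen (f - (r' : C.Sa)) ≤ basicOpen (f - (r : C.Sa)) :=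
  basicOpen_mono (sub_le_sub le_rfl (ratCast_mono h))

theorem ratCast_sub_mono {C : Context A} (g : C.Sa) {s s' : ℚ} (h : s' ≤ s) :
    basicOpen ((s' : C.Sa) - g) ≤ basicOpen ((s : C.Sa) - g) :=
  basicOpen_mono (sub_le_sub (ratCast_mono h) le_rfl)

theorem join_approximants_mono (a : selfAdjoint A) (C : Context A) {r r' s s' : ℚ} (hr : r ≤ r')
    (hs : s' ≤ s) : (gelfandSpectrum A).join (approximants a C r' s') ≤
      (gelfandSpectrum A).join (approximants a C r s) := by
  refine (((gelfandSpectrum A).isJoin_join _).le_iff' _).2 ?_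
  rintro D h _ ⟨f, g, hf, hg, rfl⟩
  exact (inf_le_inf (sub_ratCast_mono f hr) (ratCast_sub_mono g hs)).trans
    (le_join_approximants h hf hg)

/-- The opens `⋁ {D_{f-r} ∧ D_{s-g} | f ≤ a ≤ g}` define a model of the theory of the interval
domain in the frame of the internal spectrum. -/
def daseinisationModel (a : selfAdjoint A) :
    (intervalTheory (Context A)).Model (gelfandSpectrum A) where
  val {C} x := (gelfandSpectrum A).join (approximants a C (RatInterval.lo x) (RatInterval.hi x))
  naturality := by
    intro C D h x
    refine eq_of_forall_ge_iff fun y => ?_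
    rw [((gelfandSpectrum A).isJoin_join (approximants a C _ _)).le_iff h,
      ((gelfandSpectrum A).isJoin_join (approximants a D _ _)).le_iff']
    rfl
  sound := by
    rintro C _ _ (⟨x, x', hx⟩ | ⟨x, x', hx⟩ | ⟨x, x', hx⟩ | x | ⟨x, x', hx, hx'⟩ | _) y hy
    · simp only [Set.mem_singleton_iff, forall_eq, List.foldr_cons, List.foldr_nil,
        inf_top_eq] at hy ⊢
      refine InternalFrame.join_inf_join_le (F := gelfandSpectrum A) _ _ _ ?_
      rintro D h _ ⟨f, g, hf, hg, rfl⟩ _ ⟨f', g', hf', hg', rfl⟩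
      obtain ⟨f₀, g₀, hf₀, hg₀, h₀⟩ := exists_approximant a x.lo x.hi x'.lo x'.hi hf hg hf' hg'
      exact h₀.trans ((le_join_approximants h hf₀ hg₀).trans
        (OrderHomClass.mono ((gelfandSpectrum A).res h) hy))
    · simp only [Set.mem_singleton_iff, forall_eq, List.foldr_cons, List.foldr_nil,
        inf_top_eq] at hy ⊢
      exact le_trans (le_inf (join_approximants_mono a C (le_max_left _ _) (min_le_left _ _))
        (join_approximants_mono a C (le_max_right _ _) (min_le_right _ _))) hy
    · simp only [List.foldr_cons, List.foldr_nil, inf_top_eq] at hy ⊢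
      refine InternalFrame.join_inf_join_le (F := gelfandSpectrum A) _ _ _ ?_
      rintro D h _ ⟨f, g, hf, hg, rfl⟩ _ ⟨f', g', hf', hg', rfl⟩
      obtain ⟨f₀, g₀, hf₀, hg₀, h₀⟩ := exists_approximant a x.lo x.hi x'.lo x'.hi hf hg hf' hg'
      exact h₀.trans (basicOpen_disjoint (hf₀.trans hg₀) (not_lt.1 hx) _)
    · simp only [List.foldr_cons, List.foldr_nil, inf_top_eq] at hy ⊢
      refine (((gelfandSpectrum A).isJoin_join _).le_iff' _).2 ?_
      rintro D h _ ⟨f, g, hf, hg, rfl⟩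
      refine inf_basicOpen_le_of_forall _ _ _ fun e he => ?_
      rw [inf_comm]
      refine inf_basicOpen_le_of_forall _ _ _ fun d hd => ?_
      have hx := RatInterval.lo_lt_hi x
      obtain ⟨c, hc0, hce, hcd, hc⟩ : ∃ c : ℚ, 0 < c ∧ c ≤ e ∧ c ≤ d ∧
          RatInterval.lo x + c < RatInterval.hi x - c := by
        refine ⟨min (min e d) ((RatInterval.hi x - RatInterval.lo x) / 3),
          lt_min (lt_min he hd) (by linarith), (min_le_left _ _).trans (min_le_left _ _),
          (min_le_left _ _).trans (min_le_right _ _), ?_⟩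
        have := min_le_right (min e d) ((RatInterval.hi x - RatInterval.lo x) / 3)
        linarith
      have h1 := hy _ ⟨RatInterval.mk _ _ hc, lt_add_of_pos_right _ hc0, sub_lt_self _ hc0, rfl⟩
      simp only [List.foldr_cons, List.foldr_nil, inf_top_eq] at h1
      refine le_trans ?_ ((le_join_approximants h hf hg).trans
        (OrderHomClass.mono ((gelfandSpectrum A).res h) h1))
      rw [inf_comm]
      refine inf_le_inf (basicOpen_mono ?_) (basicOpen_mono ?_)
      · change f.1 - algebraMap ℂ A _ - algebraMap ℂ A _ ≤ f.1 - algebraMap ℂ A _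
        rw [sub_sub, ← map_add]
        refine sub_le_sub le_rfl ?_
        have := ratCast_mono (C := D) (r := x.lo + c) (s := x.lo + d) (by linarith)
        change algebraMap ℂ A _ ≤ algebraMap ℂ A _ at this
        rwa [Rat.cast_add x.lo d] at this
      · change algebraMap ℂ A _ - g.1 - algebraMap ℂ A _ ≤ algebraMap ℂ A _ - g.1
        rw [sub_right_comm, ← map_sub]
        refine sub_le_sub ?_ le_rfl
        have := ratCast_mono (C := D) (r := x.hi - e) (s := x.hi - c) (by linarith)
        change algebraMap ℂ A _ ≤ algebraMap ℂ A _ at this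
        rwa [Rat.cast_sub x.hi e] at this
    · simp only [Set.mem_singleton_iff, forall_eq, List.foldr_cons, List.foldr_nil,
        inf_top_eq] at hy ⊢
      exact (join_approximants_mono a C hx.le hx'.le).trans hy
    · obtain ⟨n, hn⟩ := exists_nat_ge ‖(a : A)‖
      have h1 : (-(n : ℚ) - 1) < (n : ℚ) + 1 := by
        have : (0 : ℚ) ≤ n := n.cast_nonneg
        linarith
      refine le_trans ?_ (hy _ ⟨RatInterval.mk _ _ h1, rfl⟩)
      simp only [List.foldr_cons, List.foldr_nil, inf_top_eq]
      have ha : IsSelfAdjoint (a : A) := a.2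
      have e : ((n : ℚ) : C.Sa).1 = algebraMap ℝ A n := by
        change algebraMap ℂ A _ = _
        rw [IsScalarTower.algebraMap_apply ℝ ℂ A]
        simp
      have h2 : (a : A) ≤ ((n : ℚ) : C.Sa).1 := by
        rw [e]
        exact ha.le_algebraMap_norm_self.trans (algebraMap_mono A hn)
      have h3 : (-((n : ℚ) : C.Sa)).1 ≤ (a : A) := by
        change -(((n : ℚ) : C.Sa).1) ≤ _
        rw [e]
        exact (neg_le_neg (algebraMap_mono A hn)).trans ha.neg_algebraMap_norm_le_self
      have := le_join_approximants (r := -(n : ℚ) - 1) (s := (n : ℚ) + 1) (le_refl C) h3 h2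
      rw [InternalSemilattice.res_refl] at this
      refine le_trans (le_inf (le_basicOpen_of_eq_one ?_) (le_basicOpen_of_eq_one ?_)) this
      · change -(algebraMap ℂ A _) - algebraMap ℂ A _ = 1
        rw [← map_neg, ← map_sub]
        simp
      · change algebraMap ℂ A _ - algebraMap ℂ A _ = 1
        rw [← map_sub]
        simp

/-- The Daseinisation `δ(a)` of a self-adjoint element `a`: the locale map from the internal
spectrum to the internal interval domain whose inverse image map sends the open `(r, s)` to
`⋁ {D_{f-r} ∧ D_{s-g} | f ≤ a ≤ g}`. -/
def daseinisation (a : selfAdjoint A) :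
    LocaleMap (gelfandSpectrum A) (intervalDomain (Context A)) where
  inverseImage := (daseinisationModel a).lift

end CStar

end Bohrification

/-! Monotonicity is direct: if `a ≤ b`, every `f ≤ a` satisfies `f ≤ b` and every `g ≥ b` satisfies
`g ≥ a`, so the joins that describe the two Daseinisations compare.

For the converse, put `d = b - a` and work in the single context `C` generated by `d`. It suffices
that `χ(d) ≥ 0` for each character `χ` of `C`, because these values exhaust the spectrum of `d`
(`nonneg_of_forall_evalSa`). For `c` self-adjoint let `L c` be the supremum of `χ(f)` over
self-adjoint `f ∈ C` with `f ≤ c`. Since `d ∈ C`, translation by `d` carries the elements of `C`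
below `a` onto those below `b`, so `L b = L a + χ(d)`. On the other hand `δ(a) ≤ δ(b)` forces `L a ≤
L b`, whence `χ(d) ≥ 0`. Only the lower half `(r, ∞)` of the order is needed here.

The inequality `L a ≤ L b` comes in two steps. `isJoin_lowerApproximants` identifies the inverse
image of `(r, ∞)` with the join of the `D_{f-r}`, `f ≤ a`. `exists_le_lt_evalSa` then extracts an
actual approximant from an inequality between such joins. It does so without any choice of covers,
since a character is a point of the spectrum: reading `D_c` as `χ(c) > 0` validates all axioms
(`SpectrumAx.exists_evalSa_pos`), so what follows from them is also true at `χ`.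

Injectivity follows from order reflection and antisymmetry in `A`. -/

namespace Bohrification

section CStar

variable {A : Type u} [CStarAlgebra A]

/-! ## Points of a context -/

section Points

variable {C : Context A} (χ : C.1 →⋆ₐ[ℂ] ℂ)

/-- The real value of a character of a context at a self-adjoint element. -/
noncomputable def evalSa (c : C.Sa) : ℝ := (χ ⟨c.1, c.2.1⟩).re

/-- A star homomorphism sends self-adjoint elements to numbers fixed by conjugation, so nothing is
lost in taking the real part. This is what makes `evalSa` multiplicative. -/
theorem ofReal_evalSa (c : C.Sa) : (evalSa χ c : ℂ) = χ ⟨c.1, c.2.1⟩ := by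
  refine Complex.conj_eq_iff_re.1 ?_
  change star (χ _) = _
  rw [← map_star]
  exact congrArg χ (Subtype.ext c.2.2)

theorem evalSa_one : evalSa χ 1 = 1 := by
  have h : χ ⟨(1 : C.Sa).1, (1 : C.Sa).2.1⟩ = 1 := map_one χ
  rw [evalSa, h, Complex.one_re]

theorem evalSa_neg (c : C.Sa) : evalSa χ (-c) = -evalSa χ c :=
  congrArg Complex.re (map_neg χ (⟨c.1, c.2.1⟩ : C.1))

theorem evalSa_add (c d : C.Sa) : evalSa χ (c + d) = evalSa χ c + evalSa χ d :=
  congrArg Complex.re (map_add χ (⟨c.1, c.2.1⟩ : C.1) ⟨d.1, d.2.1⟩)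

theorem evalSa_sub (c d : C.Sa) : evalSa χ (c - d) = evalSa χ c - evalSa χ d :=
  congrArg Complex.re (map_sub χ (⟨c.1, c.2.1⟩ : C.1) ⟨d.1, d.2.1⟩)

theorem evalSa_mul (c d : C.Sa) : evalSa χ (c * d) = evalSa χ c * evalSa χ d := by
  have h : χ ⟨(c * d).1, (c * d).2.1⟩ = χ ⟨c.1, c.2.1⟩ * χ ⟨d.1, d.2.1⟩ :=
    map_mul χ (⟨c.1, c.2.1⟩ : C.1) ⟨d.1, d.2.1⟩
  rw [← ofReal_evalSa, ← ofReal_evalSa, ← ofReal_evalSa] at h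
  exact_mod_cast h

theorem evalSa_ratCast (r : ℚ) : evalSa χ (r : C.Sa) = r := by
  have h : χ ⟨(r : C.Sa).1, (r : C.Sa).2.1⟩ = r := AlgHomClass.commutes χ (r : ℂ)
  rw [← ofReal_evalSa] at h
  exact_mod_cast h

/-- A character of a context is a point of the theory of the spectrum: if it makes the premise of
an axiom true, then it makes one of the alternatives of the conclusion true. -/
theorem SpectrumAx.exists_evalSa_pos {s : List C.Sa} {V : Set (List C.Sa)}
    (hV : SpectrumAx C s V) (hs : ∀ c ∈ s, 0 < evalSa χ c) :
    ∃ t ∈ V, ∀ c ∈ t, 0 < evalSa χ c := by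
  rcases hV with _ | a | b | ⟨a, b⟩ | ⟨a, b⟩ | ⟨a, b⟩ | ⟨a, b⟩ | a
  · exact ⟨_, rfl, by simp [evalSa_one]⟩
  -- There is no alternative to choose here, so the premise itself has to be contradictory; the same
  -- holds for the next case.
  · simp only [List.mem_cons, List.not_mem_nil, or_false, forall_eq_or_imp, forall_eq,
      evalSa_neg] at hs
    linarith
  · simp only [List.mem_singleton, forall_eq, evalSa_neg, evalSa_mul] at hs
    linarith [mul_self_nonneg (evalSa χ b)]
  · simp only [List.mem_singleton, forall_eq, evalSa_add] at hs
    rcases lt_or_ge 0 (evalSa χ a) with h | h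
    · exact ⟨[a], by simp, by simpa using h⟩
    · exact ⟨[b], by simp, by simp; linarith⟩
  · simp only [List.mem_singleton, forall_eq, evalSa_mul] at hs
    rcases pos_and_pos_or_neg_and_neg_of_mul_pos hs with h | h
    · exact ⟨[a, b], by simp, by simpa using h⟩
    · exact ⟨[-a, -b], by simp, by simpa [evalSa_neg] using h⟩
  · simp only [List.mem_cons, List.not_mem_nil, or_false, forall_eq_or_imp, forall_eq] at hs
    exact ⟨_, rfl, by simpa [evalSa_mul] using mul_pos hs.1 hs.2⟩
  · simp only [List.mem_cons, List.not_mem_nil, or_false, forall_eq_or_imp, forall_eq,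
      evalSa_neg, neg_pos] at hs
    exact ⟨_, rfl, by simpa [evalSa_mul] using mul_pos_of_neg_of_neg hs.1 hs.2⟩
  · simp only [List.mem_singleton, forall_eq] at hs
    -- The regularity axiom holds at `χ` because the rationals are dense: some rational `r`
    -- satisfies `0 < r < χ(a)`.
    obtain ⟨r, hr, hra⟩ := exists_rat_btwn hs
    exact ⟨_, ⟨r, by exact_mod_cast hr, rfl⟩, by simpa [evalSa_sub, evalSa_ratCast] using hra⟩

/-- The conjunctions that a character validates only if the proposition `p` holds form an ideal. -/
theorem isIdeal_evalSa_pos (p : Prop) :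
    (spectrumTheory A).IsIdeal C {l | (∀ c ∈ l, 0 < evalSa χ c) → p} where
  lower _ _ hl hp h := hp fun c hc => h c (hl hc)
  cover k s V hV hk h := by
    obtain ⟨t, ht, htpos⟩ := SpectrumAx.exists_evalSa_pos χ hV
      fun c hc => h c (List.mem_append_right _ hc)
    refine hk t ht fun c hc => ?_
    rcases List.mem_append.1 hc with hc | hc
    · exact h c (List.mem_append_left _ hc)
    · exact htpos c hc

variable [PartialOrder A] [StarOrderedRing A]

/-- As `C` is closed, the functional calculus keeps the square root of `c` inside `C`. So `c` is a
square in `C`, and its value is a square of a real number. -/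
theorem evalSa_nonneg {c : C.Sa} (hc : 0 ≤ c.1) : 0 ≤ evalSa χ c := by
  have hmem : CFC.sqrt c.1 ∈ C.1 := by
    have : IsClosed (C.1 : Set A) := C.2.1
    rw [CFC.sqrt_eq_real_sqrt _ hc, cfcₙ_eq_cfc]
    exact cfc_mem (𝕜' := ℂ) Real.sqrt c.2.1
  let b : C.Sa := ⟨CFC.sqrt c.1, hmem, .of_nonneg (CFC.sqrt_nonneg _)⟩
  have : c = b * b := Subtype.ext (CFC.sqrt_mul_sqrt_self _ hc).symm
  rw [this, evalSa_mul]
  exact mul_self_nonneg _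

theorem evalSa_mono {c d : C.Sa} (h : c.1 ≤ d.1) : evalSa χ c ≤ evalSa χ d := by
  rw [← sub_nonneg, ← evalSa_sub]
  exact evalSa_nonneg χ (sub_nonneg.2 h)

end Points

/-! ### Contexts with one generator, and positivity tested by characters -/

/-- The context generated by a self-adjoint element. -/
def contextOf (d : A) (hd : IsSelfAdjoint d) : Context A :=
  ⟨StarAlgebra.elemental ℂ d, StarAlgebra.elemental.isClosed ℂ d, fun x hx y hy => by
    -- Normality supplies the commutative ring structure that `mul_comm` uses below.
    have : IsStarNormal d := hd.isStarNormal
    exact congrArg Subtype.val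
      (mul_comm (⟨x, hx⟩ : StarAlgebra.elemental ℂ d) ⟨y, hy⟩)⟩

theorem mem_contextOf (d : A) (hd : IsSelfAdjoint d) : d ∈ (contextOf d hd).1 :=
  StarAlgebra.elemental.self_mem ℂ d

/-- The spectral values of a self-adjoint element are its values under the characters of the
context that it generates. -/
theorem exists_evalSa_eq_of_mem_spectrum {d : A} (hd : IsSelfAdjoint d) {x : ℝ}
    (hx : x ∈ spectrum ℝ d) : ∃ χ : (contextOf d hd).1 →⋆ₐ[ℂ] ℂ,
      evalSa χ ⟨d, mem_contextOf d hd, hd⟩ = x := by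
  have : IsStarNormal d := hd.isStarNormal
  have hx' : (x : ℂ) ∈ spectrum ℂ d := (spectrum.algebraMap_mem_iff ℂ).2 hx
  -- Gelfand duality for one normal generator: evaluation at `d` maps the characters onto the
  -- complex spectrum of `d`.
  obtain ⟨φ, hφ⟩ := (StarAlgebra.elemental.bijective_characterSpaceToSpectrum d).2 ⟨_, hx'⟩
  let χ : StarAlgebra.elemental ℂ d →⋆ₐ[ℂ] ℂ := (φ : StarAlgebra.elemental ℂ d →⋆ₐ[ℂ] ℂ)
  refine ⟨χ, ?_⟩
  have h : φ ⟨d, StarAlgebra.elemental.self_mem ℂ d⟩ = (x : ℂ) := congrArg Subtype.val hφ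
  exact congrArg Complex.re h

variable [PartialOrder A] [StarOrderedRing A]

theorem nonneg_of_forall_evalSa {d : A} (hd : IsSelfAdjoint d)
    (h : ∀ χ : (contextOf d hd).1 →⋆ₐ[ℂ] ℂ, 0 ≤ evalSa χ ⟨d, mem_contextOf d hd, hd⟩) :
    0 ≤ d := by
  refine (StarOrderedRing.nonneg_iff_spectrum_nonneg (R := ℝ) d hd).2 fun x hx => ?_
  obtain ⟨χ, rfl⟩ := exists_evalSa_eq_of_mem_spectrum hd hx
  exact h χ

/-! ## The lower and upper parts of the Daseinisation -/

/-- Scalars lie in every context, so a natural number above `‖a‖` serves for all of them at once.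
Hence `a` has approximants from both sides in each context. -/
theorem exists_ratCast_bounds (a : A) (ha : IsSelfAdjoint a) : ∃ q : ℚ, ∀ C : Context A,
    ((-q : ℚ) : C.Sa).1 ≤ a ∧ a ≤ (q : C.Sa).1 := by
  obtain ⟨n, hn⟩ := exists_nat_ge ‖a‖
  have e (q : ℚ) : algebraMap ℂ A q = algebraMap ℝ A q := by
    rw [IsScalarTower.algebraMap_apply ℝ ℂ A]
    simp
  refine ⟨n, fun C => ⟨?_, ?_⟩⟩
  · change algebraMap ℂ A _ ≤ a
    rw [e, Rat.cast_neg, map_neg]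
    refine (neg_le_neg (algebraMap_mono A ?_)).trans ha.neg_algebraMap_norm_le_self
    exact_mod_cast hn
  · change a ≤ algebraMap ℂ A _
    rw [e]
    refine ha.le_algebraMap_norm_self.trans (algebraMap_mono A ?_)
    exact_mod_cast hn

theorem isJoin_approximants (a : selfAdjoint A) (C : Context A) (x : RatInterval) :
    (approximants a C x.lo x.hi).IsJoin ((daseinisation a).inverseImage.app C (ioo C x)) := by
  have h : (daseinisation a).inverseImage.app C (ioo C x) =
      (gelfandSpectrum A).join (approximants a C x.lo x.hi) :=
    (daseinisationModel a).lift_gen (C := C) x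
  rw [h]
  exact (gelfandSpectrum A).isJoin_join _

/-- The internal set of all `D_{f-r}` with `f ≤ a`. -/
def lowerApproximants (a : selfAdjoint A) (C : Context A) (r : ℚ) :
    (gelfandSpectrum A).Subset C where
  carrier D _ := {x | ∃ f : D.Sa, f.1 ≤ (a : A) ∧ x = basicOpen (f - (r : D.Sa))}
  res_mem := by
    rintro D E _ k _ ⟨f, hf, rfl⟩
    exact ⟨f.incl k, hf, res_basicOpen k _⟩

/-- The internal set of all `D_{s-g}` with `a ≤ g`. -/
def upperApproximants (a : selfAdjoint A) (C : Context A) (s : ℚ) :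
    (gelfandSpectrum A).Subset C where
  carrier D _ := {x | ∃ g : D.Sa, (a : A) ≤ g.1 ∧ x = basicOpen ((s : D.Sa) - g)}
  res_mem := by
    rintro D E _ k _ ⟨g, hg, rfl⟩
    exact ⟨g.incl k, hg, res_basicOpen k _⟩

/-- Here `s - g ≥ 1`, and `D_1 = ⊤`. This and its mirror image make one of the two factors of
`D_{f-r} ∧ D_{s-g}` trivial when an end point is moved far enough out. -/
theorem top_le_basicOpen_ratCast_sub {C : Context A} {g : C.Sa} {s : ℚ}
    (h : g.1 + 1 ≤ (s : C.Sa).1) : ⊤ ≤ basicOpen ((s : C.Sa) - g) :=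
  (le_basicOpen_of_eq_one (u := (1 : C.Sa)) rfl).trans
    (basicOpen_mono (le_sub_iff_add_le'.2 h))

theorem top_le_basicOpen_sub_ratCast {C : Context A} {f : C.Sa} {r : ℚ}
    (h : (r : C.Sa).1 + 1 ≤ f.1) : ⊤ ≤ basicOpen (f - (r : C.Sa)) :=
  (le_basicOpen_of_eq_one (u := (1 : C.Sa)) rfl).trans
    (basicOpen_mono (le_sub_iff_add_le'.2 h))

theorem ratCast_add_one_le {C : Context A} {q r : ℚ} (h : q + 1 ≤ r) :
    (q : C.Sa).1 + 1 ≤ (r : C.Sa).1 := by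
  refine le_trans (le_of_eq ?_) (ratCast_mono (C := C) h)
  change algebraMap ℂ A _ + 1 = algebraMap ℂ A _
  rw [Rat.cast_add, map_add, Rat.cast_one, map_one]

/-- The upper end point and `g` disappear for two reasons: each `D_{f-r} ∧ D_{s-g}` is below
`D_{f-r}`, and `D_{f-r}` is attained by a constant `g` and a large `s`. -/
theorem isJoin_lowerApproximants (a : selfAdjoint A) (C : Context A) (r : ℚ) :
    (lowerApproximants a C r).IsJoin ((daseinisation a).inverseImage.app C (ioi C r)) := by
  have hj := (daseinisation a).inverseImage.map_isJoin _ _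
    ((intervalDomain (Context A)).isJoin_join
      { carrier := fun D (_ : C ≤ D) => {y | ∃ x : RatInterval, x.lo = r ∧ y = ioo D x}
        res_mem := by
          rintro D E _ k _ ⟨x, hx, rfl⟩
          exact ⟨x, hx, res_ioo k x⟩ })
  refine InternalSubset.IsJoin.of_le ?_ ?_
  · rintro D h _ ⟨f, hf, rfl⟩
    obtain ⟨q, hq⟩ := exists_ratCast_bounds (a : A) a.2
    -- As right end point, `r + 1` would make the interval nonempty and `q + 1` makes `D_{s-q}`
    -- equal to `⊤` for the constant upper bound `q`; the maximum does both.
    have hrs : r < max (q + 1) (r + 1) := (lt_add_one r).trans_le (le_max_right _ _)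
    have hx := hj.le h ⟨ioo D (RatInterval.mk r _ hrs), ⟨_, rfl, rfl⟩, rfl⟩
    refine le_trans ?_ hx
    have := (isJoin_approximants a D (RatInterval.mk r _ hrs)).le le_rfl
      ⟨f, (q : D.Sa), hf, (hq D).2, rfl⟩
    rw [InternalSemilattice.res_refl] at this
    refine le_trans (le_inf le_rfl (le_top.trans (top_le_basicOpen_ratCast_sub ?_))) this
    exact ratCast_add_one_le (le_max_left _ _)
  · intro D h y hy
    refine (hj.le_iff h y).2 ?_
    rintro E k _ ⟨_, ⟨x, rfl, rfl⟩, rfl⟩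
    refine ((isJoin_approximants a E x).le_iff' _).2 ?_
    rintro E' k' _ ⟨f, g, hf, -, rfl⟩
    rw [InternalSemilattice.res_trans]
    exact inf_le_left.trans (hy E' (k.trans k') _ ⟨f, hf, rfl⟩)

/-- Mirror image of `isJoin_lowerApproximants`: now the constant lower bound `-q` and a left end
point far to the left remove the factor `D_{f-r}`. -/
theorem isJoin_upperApproximants (a : selfAdjoint A) (C : Context A) (s : ℚ) :
    (upperApproximants a C s).IsJoin ((daseinisation a).inverseImage.app C (iio C s)) := by
  have hj := (daseinisation a).inverseImage.map_isJoin _ _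
    ((intervalDomain (Context A)).isJoin_join
      { carrier := fun D (_ : C ≤ D) => {y | ∃ x : RatInterval, x.hi = s ∧ y = ioo D x}
        res_mem := by
          rintro D E _ k _ ⟨x, hx, rfl⟩
          exact ⟨x, hx, res_ioo k x⟩ })
  refine InternalSubset.IsJoin.of_le ?_ ?_
  · rintro D h _ ⟨g, hg, rfl⟩
    obtain ⟨q, hq⟩ := exists_ratCast_bounds (a : A) a.2
    have hrs : min (-q - 1) (s - 1) < s := (min_le_right _ _).trans_lt (sub_one_lt s)
    have hx := hj.le h ⟨ioo D (RatInterval.mk _ s hrs), ⟨_, rfl, rfl⟩, rfl⟩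
    refine le_trans ?_ hx
    have := (isJoin_approximants a D (RatInterval.mk _ s hrs)).le le_rfl
      ⟨((-q : ℚ) : D.Sa), g, (hq D).1, hg, rfl⟩
    rw [InternalSemilattice.res_refl] at this
    refine le_trans (le_inf (le_top.trans (top_le_basicOpen_sub_ratCast ?_)) le_rfl) this
    exact ratCast_add_one_le (le_sub_iff_add_le.1 (min_le_left _ _))
  · intro D h y hy
    refine (hj.le_iff h y).2 ?_
    rintro E k _ ⟨_, ⟨x, rfl, rfl⟩, rfl⟩
    refine ((isJoin_approximants a E x).le_iff' _).2 ?_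
    rintro E' k' _ ⟨f, g, -, hg, rfl⟩
    rw [InternalSemilattice.res_trans]
    exact inf_le_right.trans (hy E' (k.trans k') _ ⟨g, hg, rfl⟩)

/-! ### Preservation and reflection of the order -/

theorem daseinisation_mono {a b : selfAdjoint A} (h : (a : A) ≤ b) :
    daseinisation a ≤ daseinisation b := by
  refine fun C => ⟨fun r => ?_, fun s => ?_⟩
  · refine ((isJoin_lowerApproximants a C r).le_iff' _).2 ?_
    rintro D k _ ⟨f, hf, rfl⟩
    exact (isJoin_lowerApproximants b C r).le k ⟨f, hf.trans h, rfl⟩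
  · refine ((isJoin_upperApproximants b C s).le_iff' _).2 ?_
    rintro D k _ ⟨g, hg, rfl⟩
    exact (isJoin_upperApproximants a C s).le k ⟨g, h.trans hg, rfl⟩

/-- If `δ(a) ≤ δ(b)`, then the pointwise supremum of the `f ≤ a` in a context is at most that of
the `f ≤ b`. -/
theorem exists_le_lt_evalSa {a b : selfAdjoint A} (h : daseinisation a ≤ daseinisation b)
    {C : Context A} (χ : C.1 →⋆ₐ[ℂ] ℂ) {f : C.Sa} (hf : f.1 ≤ (a : A)) {r : ℚ}
    (hr : r < evalSa χ f) : ∃ f' : C.Sa, f'.1 ≤ (b : A) ∧ r < evalSa χ f' := by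
  -- The explicit `join` is needed because its value at stage `C` is the ideal generated by the
  -- members at that very stage. Larger contexts play no role, so a character of `C` alone can test
  -- membership.
  have h1 : basicOpen (f - (r : C.Sa)) ≤ (gelfandSpectrum A).join (lowerApproximants b C r) := by
    have h2 := (isJoin_lowerApproximants a C r).le le_rfl ⟨f, hf, rfl⟩
    rw [InternalSemilattice.res_refl] at h2
    refine (h2.trans ((h C).1 r)).trans
      (((isJoin_lowerApproximants b C r).le_iff' _).2 fun D k z hz => ?_)
    exact ((gelfandSpectrum A).isJoin_join (lowerApproximants b C r)).le k hz
  have h3 : [f - (r : C.Sa)] ∈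
      ((spectrumTheory A).join (lowerApproximants b C r)).carrier C le_rfl :=
    h1 C le_rfl ((spectrumTheory A).subset_closure _ rfl)
  -- The proposition in the ideal is the goal itself. The closure is unfolded twice: here for the
  -- join, and below for the ideal that defines each `D_{f'-r}`. What remains at the end is `χ(f -
  -- r) > 0`, the premise for the conjunction in `h3`.
  refine (spectrumTheory A).closure_subset (isIdeal_evalSa_pos χ _) ?_ h3 ?_
  · rintro l ⟨_, ⟨f', hf', rfl⟩, hl⟩
    refine (spectrumTheory A).closure_subset (isIdeal_evalSa_pos χ _) ?_ hl
    rintro _ rfl hpos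
    refine ⟨f', hf', ?_⟩
    have : 0 < evalSa χ (f' - (r : C.Sa)) := hpos _ List.mem_cons_self
    rwa [evalSa_sub, evalSa_ratCast, sub_pos] at this
  · simpa [evalSa_sub, evalSa_ratCast] using hr

/-- The choice of context is the point: it contains `b - a`, though in general neither `a` nor `b`,
and so allows approximants of `b` to be shifted to approximants of `a`. -/
theorem le_of_daseinisation_le {a b : selfAdjoint A} (h : daseinisation a ≤ daseinisation b) :
    (a : A) ≤ b := by
  have hd : IsSelfAdjoint ((b : A) - a) := b.2.sub a.2
  refine sub_nonneg.1 (nonneg_of_forall_evalSa hd ?_)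
  set C := contextOf ((b : A) - a) hd
  set d : C.Sa := ⟨(b : A) - a, mem_contextOf _ hd, hd⟩
  intro χ
  by_contra! hneg
  obtain ⟨q, hq⟩ := exists_ratCast_bounds (a : A) a.2
  -- the values at `χ` of the elements of the context below `a`
  let S : Set ℝ := {x | ∃ f : C.Sa, f.1 ≤ (a : A) ∧ evalSa χ f = x}
  have hne : S.Nonempty := ⟨_, ((-q : ℚ) : C.Sa), (hq C).1, rfl⟩
  have hbdd : BddAbove S := by
    refine ⟨evalSa χ (q : C.Sa), ?_⟩
    rintro _ ⟨f, hf, rfl⟩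
    exact evalSa_mono χ (hf.trans (hq C).2)
  -- The supremum need not be attained, but `χ(d) < 0` leaves room for some `f ≤ a` with `χ(f) >
  -- sSup S + χ(d)`. A rational `r` fits in between, and `h` turns `f` into some `f' ≤ b` with
  -- `χ(f') > r`.
  obtain ⟨_, ⟨f, hf, rfl⟩, hlt⟩ := exists_lt_of_lt_csSup hne
    (show sSup S + evalSa χ d < sSup S by linarith)
  obtain ⟨r, hr, hr'⟩ := exists_rat_btwn hlt
  obtain ⟨f', hf', hrf'⟩ := exists_le_lt_evalSa h χ hf hr'
  -- Shifting back by `d` gives `f' - d ≤ b - d = a`, hence `χ(f') ≤ sSup S + χ(d) < r`, a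
  -- contradiction.
  have hle : evalSa χ (f' - d) ≤ sSup S := by
    refine le_csSup hbdd ⟨f' - d, ?_, rfl⟩
    change f'.1 - ((b : A) - a) ≤ a
    rw [sub_sub_eq_add_sub, add_comm, sub_le_iff_le_add]
    exact add_le_add_right hf' _
  rw [evalSa_sub] at hle
  linarith

end CStar

end Bohrification

theorem proposition5p1 {A : Type u} [CStarAlgebra A] [PartialOrder A] [StarOrderedRing A] :
    (∀ (a : selfAdjoint A) (C : Bohrification.Context A) (x : Bohrification.RatInterval),
      (Bohrification.approximants a C x.lo x.hi).IsJoin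
        ((Bohrification.daseinisation a).inverseImage.app C (Bohrification.ioo C x))) ∧
    Function.Injective (fun a : selfAdjoint A => (Bohrification.daseinisation a :
      Bohrification.LocaleMap (Bohrification.gelfandSpectrum A)
        (Bohrification.intervalDomain (Bohrification.Context A)))) ∧
    ∀ a b : selfAdjoint A,
      (a : A) ≤ (b : A) ↔ Bohrification.daseinisation a ≤ Bohrification.daseinisation b := by
  refine ⟨Bohrification.isJoin_approximants, fun a b h => ?_,
    fun a b => ⟨Bohrification.daseinisation_mono, Bohrification.le_of_daseinisation_le⟩⟩
  have h' : Bohrification.daseinisation a = Bohrification.daseinisation b := h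
  refine Subtype.ext (le_antisymm (Bohrification.le_of_daseinisation_le ?_)
    (Bohrification.le_of_daseinisation_le ?_))
  -- The order on locale maps is a bare `LE`, so its reflexivity at a Daseinisation is obtained from
  -- monotonicity.
  · rw [← h']
    exact Bohrification.daseinisation_mono le_rfl
  · rw [h']
    exact Bohrification.daseinisation_mono le_rfl
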